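/- A BPP system consists of a finite set $V$ of variables, a finite set $Act$ of actions with a distinguished silent action $\tau\in Act$, and a finite set of rules $X\xrightarrow{a}\gamma$ with $X\in V$, $a\in Act$ and $\gamma$ a finite multiset over $V$. A process is a finite multiset over $V$; writing union of multisets as juxtaposition, each rule $X\xrightarrow{a}\gamma$ induces the steps $X\delta\xrightarrow{a}\gamma\delta$ for all processes $\delta$. Weak steps are $\stackrel{\tau}{\Rightarrow}\;=\;(\xrightarrow{\tau})^*$ and $\stackrel{a}{\Rightarrow}\;=\;(\xrightarrow{\tau})^*\xrightarrow{a}(\xrightarrow{\tau})^*$ for $a\neq\tau$. Weak bisimilarity $\approx$ is the union of all symmetric relations $B$ on processes such that $\alpha\mathrel{B}\beta$ and $\alpha\xrightarrow{a}\alpha'$ with $a\in Act$ imply $\beta\stackrel{a}{\Rightarrow}\beta'$ for some $\beta'$ with $\alpha'\mathrel{B}\beta'$. The long-long approximants $\approx^L_o$ ($o$ an ordinal) are defined by: $\approx^L_0$ relates all pairs of processes; $\alpha\approx^L_{o+1}\beta$ iff for every $a\in Act$, every $\alpha\stackrel{a}{\Rightarrow}\alpha'$ is answered by some $\beta\stackrel{a}{\Rightarrow}\beta'$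 with $\alpha'\approx^L_o\beta'$, and every $\beta\stackrel{a}{\Rightarrow}\beta'$ is answered by some $\alpha\stackrel{a}{\Rightarrow}\alpha'$ with $\alpha'\approx^L_o\beta'$; and $\approx^L_\lambda\;=\;\bigcap_{i<\lambda}\approx^L_i$ for limit ordinals $\lambda$. **Theorem.** The long-long approximants do not stabilize below level $\omega^2$ for BPP: for every finite $k\ge 0$ there is a BPP system in which $\approx\;\neq\;\approx^L_{\omega\cdot k}$. Consequently there is no ordinal $o<\omega^2$ such that $\approx\;=\;\approx^L_o$ holds in every BPP system; in particular, it is not true that $\approx\;=\;\approx^L_{\omega+\omega}$ in every BPP system, which refutes the conjecture of Hirshfeld and Jančar. -/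

import Mathlib

/-- A process description for Basic Parallel Processes (BPP): a finite set `V` of variables, a finite
set `Act` of actions containing the silent action `tau`, and a finite set of rules `X --a--> γ`,
each recorded as a triple `(X, a, γ)` with `γ` a multiset of variables. -/
structure BPP where
  V : Type
  Act : Type
  finite_V : Finite V
  finite_Act : Finite Act
  tau : Act
  rules : Finset (V × Act × Multiset V)

namespace BPP

/-- A process is a finite multiset of variables, read as their parallel composition. -/
abbrev Proc (S : BPP) : Type := Multiset S.V

/-- Strong steps: a rule `X --a--> γ` yields `X δ --a--> γ δ` for every process `δ`. -/
def Step (S : BPP) (a : S.Act) (α β : S.Proc) : Prop :=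
  ∃ (X : S.V) (γ δ : S.Proc), (X, a, γ) ∈ S.rules ∧ α = X ::ₘ δ ∧ β = γ + δ

/-- Finitely many (possibly zero) silent steps. -/
def SilentSteps (S : BPP) : S.Proc → S.Proc → Prop :=
  Relation.ReflTransGen (S.Step S.tau)

/-- Weak steps labelled by a single action: `τ*` for the silent action, and `τ* a τ*` for a
visible action `a`. -/
def WeakStep (S : BPP) (a : S.Act) (α β : S.Proc) : Prop :=
  (a = S.tau ∧ S.SilentSteps α β) ∨
    (a ≠ S.tau ∧ ∃ α' β', S.SilentSteps α α' ∧ S.Step a α' β' ∧ S.SilentSteps β' β)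

/-- Weak bisimulations: symmetric relations in which every strong step is answered by an equally
labelled weak step. -/
def IsWeakBisimulation (S : BPP) (B : S.Proc → S.Proc → Prop) : Prop :=
  (∀ α β, B α β → B β α) ∧
    ∀ α β, B α β → ∀ a α', S.Step a α α' → ∃ β', S.WeakStep a β β' ∧ B α' β'

/-- Weak bisimilarity `≈`. -/
def WeakBisimilar (S : BPP) (α β : S.Proc) : Prop :=
  ∃ B : S.Proc → S.Proc → Prop, S.IsWeakBisimulation B ∧ B α β

/-- The transfinite sequence of approximants of a refinement function `Ψ`: the full relation at `0`,
`Ψ` applied to the previous relation at successors, intersections at limits. -/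
noncomputable def approximant (S : BPP)
    (Ψ : (S.Proc → S.Proc → Prop) → (S.Proc → S.Proc → Prop)) (o : Ordinal.{0}) :
    S.Proc → S.Proc → Prop :=
  Ordinal.limitRecOn (motive := fun _ => S.Proc → S.Proc → Prop) o
    (fun _ _ => True)
    (fun _ R => Ψ R)
    (fun l _ R => fun α β => ∀ (i : Ordinal.{0}) (hi : i < l), R i hi α β)

theorem approximant_zero (S : BPP)
    (Ψ : (S.Proc → S.Proc → Prop) → (S.Proc → S.Proc → Prop)) (α β : S.Proc) :
    S.approximant Ψ 0 α β := by
  simp [approximant]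

theorem approximant_succ (S : BPP)
    (Ψ : (S.Proc → S.Proc → Prop) → (S.Proc → S.Proc → Prop)) (o : Ordinal.{0}) :
    S.approximant Ψ (Order.succ o) = Ψ (S.approximant Ψ o) := by
  simp [approximant]

theorem approximant_limit (S : BPP)
    (Ψ : (S.Proc → S.Proc → Prop) → (S.Proc → S.Proc → Prop)) (o : Ordinal.{0})
    (ho : Order.IsSuccLimit o) (α β : S.Proc) :
    S.approximant Ψ o α β ↔ ∀ i < o, S.approximant Ψ i α β := by
  simp only [approximant]
  rw [Ordinal.limitRecOn_limit _ _ _ _ ho]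

/-- One round of the long-long game: Spoiler picks one of the two processes and makes a weak step
labelled by a single action from it, then Duplicator answers by a weak step with the same label from
the other process, reaching a pair of processes related by `R`. -/
def longLongRefine (S : BPP) (R : S.Proc → S.Proc → Prop) (α β : S.Proc) : Prop :=
  (∀ a α', S.WeakStep a α α' → ∃ β', S.WeakStep a β β' ∧ R α' β') ∧
    (∀ a β', S.WeakStep a β β' → ∃ α', S.WeakStep a α α' ∧ R α' β')

/-- The long-long approximant `≈^L_o`. -/
noncomputable def LongLongApprox (S : BPP) (o : Ordinal.{0}) : S.Proc → S.Proc → Prop :=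
  S.approximant S.longLongRefine o

end BPP

/-! The witness compares `A` with `B` at the top level k. The action `(true, j)` takes `A` to `A`
one level lower, whereas `B` can only reach `G` there. Then `G` silently produces any finite number
of `Y`, and one `Y` is enough to match the next descent of `A`. Spoiler therefore freezes every `G`
into `B`, consumes the `Y` one by one and descends again; at level 0, `A` still has a `(true, 0)`
move and `B` has none. So the two are not bisimilar (`not_weakBisimilar`).

A weak step carries at most one visible action, so a long round removes at most one `Y` of the
current level. Duplicator fixes their number after seeing the ordinal that remains, so each level is
worth ω rounds (`longLongApprox_of_le`).

Spoiler's other moves do not help. Every sort except `Y` spawns all variables of higher levels,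
which hides differences above a common generator (`SameCore`), and an `A` at the lowest level hides
everything else (`SameTop`). Such moves keep Duplicator's invariant or lead to these bisimilar
pairs. -/

namespace Ladder

/-! ### The ladder system -/

/-- The four sorts of variables of a ladder system. -/
inductive Kind where
  | A
  | B
  | G
  | Y

instance : Finite Kind :=
  Finite.of_surjective (fun i : Fin 4 => ![Kind.A, Kind.B, Kind.G, Kind.Y] i) (by
    rintro (_ | _)
    exacts [⟨0, rfl⟩, ⟨1, rfl⟩, ⟨2, rfl⟩, ⟨3, rfl⟩])

/-- Variables: a sort together with a level. -/
abbrev Var (k : ℕ) : Type := Kind × Fin (k + 1)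

/-- Actions: `none` is silent, and every level carries two visible actions. -/
abbrev Label (k : ℕ) : Type := Option (Bool × Fin (k + 1))

/-- The rules of the ladder system with levels `0, …, k`. -/
inductive Rule (k : ℕ) : Var k → Label k → Multiset (Var k) → Prop
  | spawn (x : Kind) (hx : x ≠ .Y) (j : Fin (k + 1)) (z : Var k) (h : j < z.2) :
      Rule k (x, j) none {(x, j), z}
  | loop (x : Kind) (hx : x ≠ .Y) (j : Fin (k + 1)) :
      Rule k (x, j) (some (false, j)) {(x, j)}
  | down (x : Kind) (hx : x ≠ .Y) (i j : Fin (k + 1)) (h : (i : ℕ) + 1 = j) :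
      Rule k (x, j) (some (true, j)) {(.G, i)}
  -- Subtraction is truncated: at level 0 this rule gives `A` at level 0 again, while `down` does
  -- not apply there. This is what finally separates `A` from `B`.
  | lower (x : Kind) (hx : x = .A ∨ x = .Y) (i j : Fin (k + 1)) (h : (i : ℕ) = j - 1) :
      Rule k (x, j) (some (true, j)) {(.A, i)}
  | consume (j : Fin (k + 1)) : Rule k (.Y, j) (some (false, j)) 0
  | pump (j : Fin (k + 1)) : Rule k (.G, j) none {(.G, j), (.Y, j)}
  | freeze (j : Fin (k + 1)) : Rule k (.G, j) none {(.B, j)}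

theorem finite_rules (k : ℕ) :
    {r : Var k × Label k × Multiset (Var k) | Rule k r.1 r.2.1 r.2.2}.Finite := by
  -- Right-hand sides have at most two variables, so the rules lie in the range of a map from a
  -- finite type.
  let f : Var k × Label k × Option (Var k) × Option (Var k) →
      Var k × Label k × Multiset (Var k) :=
    fun t => (t.1, t.2.1, t.2.2.1.elim 0 (fun v => {v}) + t.2.2.2.elim 0 (fun v => {v}))
  refine (Set.finite_range f).subset ?_
  rintro ⟨X, a, γ⟩ h
  have key : ∃ u v : Option (Var k),
      u.elim 0 (fun v => {v}) + v.elim 0 (fun v => {v}) = γ := by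
    cases h with
    | spawn x hx j z h => exact ⟨some (x, j), some z, rfl⟩
    | loop x hx j => exact ⟨some (x, j), none, rfl⟩
    | down x hx i j h => exact ⟨some (.G, i), none, rfl⟩
    | lower x hx i j h => exact ⟨some (.A, i), none, rfl⟩
    | consume j => exact ⟨none, none, rfl⟩
    | pump j => exact ⟨some (.G, j), some (.Y, j), rfl⟩
    | freeze j => exact ⟨some (.B, j), none, rfl⟩
  obtain ⟨u, v, huv⟩ := key
  exact ⟨(X, a, u, v), by simp only [f, huv]⟩

/-- The ladder system with levels `0, …, k`. -/
noncomputable abbrev system (k : ℕ) : BPP where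
  V := Var k
  Act := Label k
  finite_V := inferInstance
  finite_Act := inferInstance
  tau := none
  rules := (finite_rules k).toFinset

variable {k : ℕ}

theorem step_iff {a : Label k} {p q : Multiset (Var k)} :
    (system k).Step a p q ↔ ∃ X η ρ, Rule k X a η ∧ p = X ::ₘ ρ ∧ q = η + ρ := by
  simp [BPP.Step]

theorem Rule.step {X : Var k} {a : Label k} {η : Multiset (Var k)} (h : Rule k X a η)
    (ρ : Multiset (Var k)) : (system k).Step a (X ::ₘ ρ) (η + ρ) :=
  step_iff.2 ⟨X, η, ρ, h, rfl, rfl⟩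

end Ladder

/-! ### Weak steps and weak bisimilarity in general -/

namespace BPP

variable {S : BPP}

theorem WeakStep.trans_silent {a : S.Act} {α β γ : S.Proc} (h : S.WeakStep a α β)
    (h' : S.SilentSteps β γ) : S.WeakStep a α γ := by
  rcases h with ⟨ha, h⟩ | ⟨ha, δ, ε, h1, h2, h3⟩
  · exact .inl ⟨ha, h.trans h'⟩
  · exact .inr ⟨ha, δ, ε, h1, h2, h3.trans h'⟩

theorem SilentSteps.trans_weakStep {a : S.Act} {α β γ : S.Proc} (h : S.SilentSteps α β)
    (h' : S.WeakStep a β γ) : S.WeakStep a α γ := by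
  rcases h' with ⟨ha, h'⟩ | ⟨ha, δ, ε, h1, h2, h3⟩
  · exact .inl ⟨ha, h.trans h'⟩
  · exact .inr ⟨ha, δ, ε, h.trans h1, h2, h3⟩

theorem Step.weakStep {a : S.Act} {α β : S.Proc} (h : S.Step a α β) : S.WeakStep a α β := by
  by_cases ha : a = S.tau
  · subst ha
    exact .inl ⟨rfl, .single h⟩
  · exact .inr ⟨ha, α, β, .refl, h, .refl⟩

theorem WeakStep.silent {α β : S.Proc} (h : S.WeakStep S.tau α β) : S.SilentSteps α β := by
  rcases h with ⟨_, h⟩ | ⟨h, _⟩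
  · exact h
  · exact absurd rfl h

theorem WeakBisimilar.symm {α β : S.Proc} (h : S.WeakBisimilar α β) : S.WeakBisimilar β α := by
  obtain ⟨R, hR, h⟩ := h
  exact ⟨R, hR, hR.1 _ _ h⟩

theorem WeakBisimilar.step {a : S.Act} {α β α' : S.Proc} (h : S.WeakBisimilar α β)
    (hs : S.Step a α α') : ∃ β', S.WeakStep a β β' ∧ S.WeakBisimilar α' β' := by
  obtain ⟨R, hR, h⟩ := h
  obtain ⟨β', h1, h2⟩ := hR.2 _ _ h _ _ hs
  exact ⟨β', h1, R, hR, h2⟩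

theorem WeakBisimilar.silentSteps {α β α' : S.Proc} (h : S.WeakBisimilar α β)
    (hs : S.SilentSteps α α') : ∃ β', S.SilentSteps β β' ∧ S.WeakBisimilar α' β' := by
  induction hs with
  | refl => exact ⟨β, .refl, h⟩
  | tail _ hs ih =>
    obtain ⟨β', h1, h2⟩ := ih
    obtain ⟨β'', h3, h4⟩ := h2.step hs
    exact ⟨β'', h1.trans h3.silent, h4⟩

theorem WeakBisimilar.weakStep {a : S.Act} {α β α' : S.Proc} (h : S.WeakBisimilar α β)
    (hs : S.WeakStep a α α') : ∃ β', S.WeakStep a β β' ∧ S.WeakBisimilar α' β' := by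
  rcases hs with ⟨ha, hs⟩ | ⟨ha, δ, ε, h1, h2, h3⟩
  · obtain ⟨β', h1, h2⟩ := h.silentSteps hs
    exact ⟨β', .inl ⟨ha, h1⟩, h2⟩
  · obtain ⟨δ', g1, h⟩ := h.silentSteps h1
    obtain ⟨ε', g2, h⟩ := h.step h2
    obtain ⟨β', g3, h⟩ := h.silentSteps h3
    exact ⟨β', (g1.trans_weakStep g2).trans_silent g3, h⟩

/-- Weak bisimilarity is finer than all long-long approximants. -/
theorem WeakBisimilar.longLongApprox {α β : S.Proc} (h : S.WeakBisimilar α β) (o : Ordinal.{0}) :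
    S.LongLongApprox o α β := by
  induction o using Ordinal.limitRecOn generalizing α β with
  | zero => exact S.approximant_zero _ _ _
  | add_one o ih =>
    rw [LongLongApprox, ← Order.succ_eq_add_one, approximant_succ]
    refine ⟨fun a α' hs => ?_, fun a β' hs => ?_⟩
    · obtain ⟨β', h1, h2⟩ := h.weakStep hs
      exact ⟨β', h1, ih h2⟩
    · obtain ⟨α', h1, h2⟩ := h.symm.weakStep hs
      exact ⟨α', h1, ih h2.symm⟩
  | limit o ho ih => exact (S.approximant_limit _ o ho _ _).2 fun i hi => ih i hi h

end BPP

namespace Ladder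
variable {k : ℕ}

/-! ### Levels and generators -/

/-- All variables of `p` have level at least `j`. -/
def From (j : Fin (k + 1)) (p : Multiset (Var k)) : Prop := ∀ z ∈ p, j ≤ z.2

/-- `p` contains a variable of level `j` of a sort other than `Y`. -/
def HasGen (j : Fin (k + 1)) (p : Multiset (Var k)) : Prop := ∃ x : Kind, x ≠ .Y ∧ (x, j) ∈ p

theorem From.add {j : Fin (k + 1)} {p q : Multiset (Var k)} (hp : From j p) (hq : From j q) :
    From j (p + q) := fun z hz => (Multiset.mem_add.1 hz).elim (hp z) (hq z)

theorem From.mono {i j : Fin (k + 1)} {p : Multiset (Var k)} (hp : From j p) (h : i ≤ j) :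
    From i p := fun z hz => h.trans (hp z hz)

theorem From.tail {j : Fin (k + 1)} {z : Var k} {p : Multiset (Var k)} (hp : From j (z ::ₘ p)) :
    From j p := fun w hw => hp w (Multiset.mem_cons_of_mem hw)

theorem Rule.from_of_silent {X : Var k} {η : Multiset (Var k)} (h : Rule k X none η) :
    From X.2 η := by
  cases h with
  | spawn x hx j z h =>
    intro w hw
    simp only [Multiset.insert_eq_cons, Multiset.mem_cons, Multiset.mem_singleton] at hw
    rcases hw with rfl | rfl
    exacts [le_rfl, h.le]
  | pump j => intro w hw; simp at hw; rcases hw with (rfl | rfl); exacts [le_rfl, le_rfl]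
  | freeze j => intro w hw; simp at hw; subst hw; exact le_rfl

theorem Rule.le_succ {X : Var k} {a : Label k} {η : Multiset (Var k)} (h : Rule k X a η) :
    ∀ z ∈ η, (X.2 : ℕ) ≤ z.2 + 1 := by
  cases h with
  | spawn x hx j z h =>
    intro w hw
    simp only [Multiset.insert_eq_cons, Multiset.mem_cons, Multiset.mem_singleton] at hw
    have := Fin.lt_def.1 h
    rcases hw with rfl | rfl <;> (simp; try omega)
  | loop x hx j => simp
  | down x hx i j h => simp; omega
  | lower x hx i j h => simp; omega
  | consume j => simp
  | pump j => simp
  | freeze j => simp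

/-- No rule descends more than one level, so a variable above level j can be spawned and used
without falling below j. -/
theorem Rule.from_of_lt {X : Var k} {a : Label k} {η : Multiset (Var k)} {j : Fin (k + 1)}
    (h : Rule k X a η) (hj : j < X.2) : From j η := by
  intro z hz
  have := h.le_succ z hz
  have := Fin.lt_def.1 hj
  exact Fin.le_def.2 (by omega)

theorem Rule.mem_A_of_silent {j : Fin (k + 1)} {η : Multiset (Var k)}
    (h : Rule k (.A, j) none η) : (Kind.A, j) ∈ η := by
  cases h; simp

theorem Rule.hasGen_of_silent {x : Kind} {j : Fin (k + 1)} {η : Multiset (Var k)}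
    (h : Rule k (x, j) none η) : HasGen j η := by
  cases h with
  | spawn x hx j z h => exact ⟨x, hx, by simp⟩
  | pump j => exact ⟨.G, by simp, by simp⟩
  | freeze j => exact ⟨.B, by simp, by simp⟩

theorem Rule.hasGen {x : Kind} {j : Fin (k + 1)} {a : Label k} {η : Multiset (Var k)}
    (h : Rule k (x, j) a η) (hx : x ≠ .Y) : ∃ i ≤ j, HasGen i η := by
  cases h with
  | spawn x hx j z h => exact ⟨j, le_rfl, x, hx, by simp⟩
  | loop x hx j => exact ⟨j, le_rfl, x, hx, by simp⟩
  | down x hx i j h => exact ⟨i, Fin.le_def.2 (by omega), .G, by simp, by simp⟩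
  | lower x hx i j h => exact ⟨i, Fin.le_def.2 (by omega), .A, by simp, by simp⟩
  | consume j => exact absurd rfl hx
  | pump j => exact ⟨j, le_rfl, .G, by simp, by simp⟩
  | freeze j => exact ⟨j, le_rfl, .B, by simp, by simp⟩

theorem HasGen.spawn {j : Fin (k + 1)} {p : Multiset (Var k)} (hp : HasGen j p) {z : Var k}
    (hz : j < z.2) : (system k).Step none p (z ::ₘ p) := by
  obtain ⟨x, hx, hm⟩ := hp
  obtain ⟨ρ, rfl⟩ := Multiset.exists_cons_of_mem hm
  have := (Rule.spawn x hx j z hz).step ρ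
  rwa [Multiset.insert_eq_cons, Multiset.cons_add, Multiset.singleton_add,
    Multiset.cons_swap] at this

/-- A generator can create any variable of a higher level and then use it. -/
theorem HasGen.weakStep {j : Fin (k + 1)} {p : Multiset (Var k)} (hp : HasGen j p) {z : Var k}
    (hz : j < z.2) {a : Label k} {η : Multiset (Var k)} (h : Rule k z a η) :
    (system k).WeakStep a p (η + p) :=
  BPP.SilentSteps.trans_weakStep (.single (hp.spawn hz)) (h.step p).weakStep

theorem HasGen.loop {j : Fin (k + 1)} {p : Multiset (Var k)} (hp : HasGen j p) :
    (system k).WeakStep (some (false, j)) p p := by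
  obtain ⟨x, hx, hm⟩ := hp
  obtain ⟨ρ, rfl⟩ := Multiset.exists_cons_of_mem hm
  exact ((Rule.loop x hx j).step ρ).weakStep

theorem HasGen.mono {j : Fin (k + 1)} {p q : Multiset (Var k)} (hp : HasGen j p) (h : p ⊆ q) :
    HasGen j q := hp.imp fun _ hx => ⟨hx.1, h hx.2⟩

/-! ### Bisimilar pairs -/

/-- Processes with a common part containing a generator of level `j` whose remaining variables all
have higher levels. -/
def SameCore (p q : Multiset (Var k)) : Prop :=
  ∃ j δ γ γ', p = δ + γ ∧ q = δ + γ' ∧ HasGen j δ ∧ (∀ z ∈ γ, j < z.2) ∧ ∀ z ∈ γ', j < z.2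

/-- Processes of levels at least `j` which both contain `A` at level `j`. -/
def SameTop (p q : Multiset (Var k)) : Prop :=
  ∃ j, (Kind.A, j) ∈ p ∧ (Kind.A, j) ∈ q ∧ From j p ∧ From j q

/-- Steps of the common part are copied. A step of a higher variable is imitated by spawning that
variable first, and its result joins the common part. -/
theorem SameCore.answer {p q p' : Multiset (Var k)} {a : Label k} (h : SameCore p q)
    (hs : (system k).Step a p p') : ∃ q', (system k).WeakStep a q q' ∧ SameCore p' q' := by
  obtain ⟨j, δ, γ, γ', rfl, rfl, hg, h1, h2⟩ := h
  obtain ⟨X, η, ρ, hr, hp, rfl⟩ := step_iff.1 hs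
  have hX : X ∈ δ + γ := hp ▸ Multiset.mem_cons_self X ρ
  rcases Multiset.mem_add.1 hX with hX | hX
  · obtain ⟨δ, rfl⟩ := Multiset.exists_cons_of_mem hX
    rw [Multiset.cons_add, Multiset.cons_inj_right] at hp
    subst hp
    refine ⟨η + (δ + γ'), ?_, ?_⟩
    · rw [Multiset.cons_add]
      exact (hr.step _).weakStep
    · have : ∃ i ≤ j, HasGen i (η + δ) := by
        obtain ⟨x, hx, hm⟩ := hg
        rcases Multiset.mem_cons.1 hm with rfl | hm
        · obtain ⟨i, hi, hη⟩ := hr.hasGen hx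
          exact ⟨i, hi, hη.mono fun _ => Multiset.mem_add.2 ∘ .inl⟩
        · exact ⟨j, le_rfl, x, hx, Multiset.mem_add.2 (.inr hm)⟩
      obtain ⟨i, hi, hη⟩ := this
      exact ⟨i, η + δ, γ, γ', (add_assoc ..).symm, (add_assoc ..).symm, hη,
        fun z hz => hi.trans_lt (h1 z hz), fun z hz => hi.trans_lt (h2 z hz)⟩
  · obtain ⟨γ, rfl⟩ := Multiset.exists_cons_of_mem hX
    rw [Multiset.add_cons, Multiset.cons_inj_right] at hp
    subst hp
    refine ⟨η + (δ + γ'), HasGen.weakStep (hg.mono fun _ => Multiset.mem_add.2 ∘ .inl)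
      (h1 X (Multiset.mem_cons_self ..)) hr, j, η + δ, γ, γ', (add_assoc ..).symm,
      (add_assoc ..).symm, hg.mono fun _ => Multiset.mem_add.2 ∘ .inr,
      fun z hz => h1 z (Multiset.mem_cons_of_mem hz), h2⟩

theorem sameCore_of_from {i j : Fin (k + 1)} (h : (i : ℕ) + 1 = j) {p q : Multiset (Var k)}
    (hp : From j p) (hq : From j q) : SameCore ({(.G, i)} + p) ({(.G, i)} + q) := by
  have hij : i < j := Fin.lt_def.2 (by omega)
  exact ⟨i, {(.G, i)}, p, q, rfl, rfl, ⟨.G, by simp, by simp⟩, fun z hz => hij.trans_le (hp z hz),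
    fun z hz => hij.trans_le (hq z hz)⟩

theorem sameTop_of_from {i j : Fin (k + 1)} (h : i ≤ j) {p q : Multiset (Var k)}
    (hp : From j p) (hq : From j q) : SameTop ({(.A, i)} + p) ({(.A, i)} + q) := by
  have hi : From i ({(Kind.A, i)} : Multiset (Var k)) := by
    intro z hz; rw [Multiset.mem_singleton.1 hz]
  exact ⟨i, by simp, by simp, hi.add (hp.mono h), hi.add (hq.mono h)⟩

/-- The visible rules of a variable of level `j` that do not stay at level `j`. -/
theorem Rule.visible {x : Kind} {j : Fin (k + 1)} {a : Label k} {η : Multiset (Var k)}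
    (h : Rule k (x, j) a η) (ha : a ≠ none) :
    (a = some (false, j) ∧ η ≤ {(x, j)} ∧ (x = .Y ∨ η = {(x, j)})) ∨
    (a = some (true, j) ∧ ∃ i : Fin (k + 1), (i : ℕ) + 1 = j ∧ η = {(.G, i)}) ∨
    (a = some (true, j) ∧ ∃ i : Fin (k + 1), (i : ℕ) = j - 1 ∧ η = {(.A, i)}) := by
  cases h with
  | spawn | pump | freeze => exact absurd rfl ha
  | loop x hx j => exact .inl ⟨rfl, le_rfl, .inr rfl⟩
  | down x hx i j h => exact .inr (.inl ⟨rfl, i, h, rfl⟩)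
  | lower x hx i j h => exact .inr (.inr ⟨rfl, i, h, rfl⟩)
  | consume j => exact .inl ⟨rfl, Multiset.zero_le _, .inl rfl⟩

/-- Above level j, `A` spawns what it needs; at level j, silent steps are answered by idling and
`(false, j)` by the loop. Both kinds of descent are available to `A` itself. -/
theorem SameTop.answer {p q p' : Multiset (Var k)} {a : Label k} (h : SameTop p q)
    (hs : (system k).Step a p p') :
    ∃ q', (system k).WeakStep a q q' ∧ (SameCore p' q' ∨ SameTop p' q') := by
  obtain ⟨j, hA, hA', hp, hq⟩ := h
  obtain ⟨⟨x, l⟩, η, ρ, hr, rfl, rfl⟩ := step_iff.1 hs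
  have hgen : HasGen j q := ⟨.A, by simp, hA'⟩
  have hρ := hp.tail
  rcases (hp _ (Multiset.mem_cons_self ..)).lt_or_eq with hl | hl
  · refine ⟨η + q, hgen.weakStep hl hr, .inr ⟨j, ?_, by simp [hA'], (hr.from_of_lt hl).add hρ,
      (hr.from_of_lt hl).add hq⟩⟩
    rcases Multiset.mem_cons.1 hA with h | h
    · rw [← h] at hl; exact absurd hl (lt_irrefl _)
    · simp [h]
  · dsimp only at hl
    subst hl
    by_cases ha : a = none
    · subst ha
      refine ⟨q, .inl ⟨rfl, .refl⟩, .inr ⟨j, ?_, hA', hr.from_of_silent.add hρ, hq⟩⟩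
      rcases Multiset.mem_cons.1 hA with h | h
      · rw [← h] at hr
        exact Multiset.mem_add.2 (.inl hr.mem_A_of_silent)
      · simp [h]
    rcases hr.visible ha with ⟨rfl, hle, hx⟩ | ⟨rfl, i, hi, rfl⟩ | ⟨rfl, i, hi, rfl⟩
    · refine ⟨q, hgen.loop, .inr ⟨j, ?_, hA', ?_, hq⟩⟩
      · rcases Multiset.mem_cons.1 hA with h | h
        · rcases hx with rfl | rfl
          · simp at h
          · simp [h]
        · simp [h]
      · refine From.add (fun z hz => hp z ?_) hρ
        rw [Multiset.mem_singleton.1 (Multiset.mem_of_le hle hz)]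
        exact Multiset.mem_cons_self ..
    · obtain ⟨q, rfl⟩ := Multiset.exists_cons_of_mem hA'
      exact ⟨_, ((Rule.down .A (by simp) i j hi).step q).weakStep,
        .inl (sameCore_of_from hi hρ hq.tail)⟩
    · obtain ⟨q, rfl⟩ := Multiset.exists_cons_of_mem hA'
      exact ⟨_, ((Rule.lower .A (.inl rfl) i j hi).step q).weakStep,
        .inr (sameTop_of_from (Fin.le_def.2 (by omega)) hρ hq.tail)⟩

theorem isWeakBisimulation (k : ℕ) :
    (system k).IsWeakBisimulation fun p q => SameCore p q ∨ SameTop p q := by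
  refine ⟨?_, ?_⟩
  · rintro p q (⟨j, δ, γ, γ', h1, h2, h3, h4, h5⟩ | ⟨j, h1, h2, h3, h4⟩)
    · exact .inl ⟨j, δ, γ', γ, h2, h1, h3, h5, h4⟩
    · exact .inr ⟨j, h2, h1, h4, h3⟩
  · rintro p q (h | h) a p' hs
    · exact (h.answer hs).imp fun _ h => ⟨h.1, .inl h.2⟩
    · exact h.answer hs

theorem SameCore.weakBisimilar {p q : Multiset (Var k)} (h : SameCore p q) :
    (system k).WeakBisimilar p q := ⟨_, isWeakBisimulation k, .inl h⟩

theorem SameTop.weakBisimilar {p q : Multiset (Var k)} (h : SameTop p q) :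
    (system k).WeakBisimilar p q := ⟨_, isWeakBisimulation k, .inr h⟩

/-! ### Invariants of silent steps -/

theorem From.silentSteps {j : Fin (k + 1)} {p q : Multiset (Var k)} (hp : From j p)
    (h : (system k).SilentSteps p q) : From j q := by
  induction h with
  | refl => exact hp
  | tail _ hs ih =>
    obtain ⟨X, η, ρ, hr, rfl, rfl⟩ := step_iff.1 hs
    exact From.add (hr.from_of_silent.mono (ih X (Multiset.mem_cons_self ..))) ih.tail

theorem mem_A_of_silentSteps {j : Fin (k + 1)} {p q : Multiset (Var k)} (hp : (Kind.A, j) ∈ p)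
    (h : (system k).SilentSteps p q) : (Kind.A, j) ∈ q := by
  induction h with
  | refl => exact hp
  | tail _ hs ih =>
    obtain ⟨X, η, ρ, hr, rfl, rfl⟩ := step_iff.1 hs
    rcases Multiset.mem_cons.1 ih with rfl | h
    · exact Multiset.mem_add.2 (.inl hr.mem_A_of_silent)
    · exact Multiset.mem_add.2 (.inr h)

theorem HasGen.silentSteps {j : Fin (k + 1)} {p q : Multiset (Var k)} (hp : HasGen j p)
    (h : (system k).SilentSteps p q) : HasGen j q := by
  induction h with
  | refl => exact hp
  | tail _ hs ih =>
    obtain ⟨X, η, ρ, hr, rfl, rfl⟩ := step_iff.1 hs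
    obtain ⟨x, hx, hm⟩ := ih
    rcases Multiset.mem_cons.1 hm with rfl | h
    · exact hr.hasGen_of_silent.mono fun _ => Multiset.mem_add.2 ∘ .inl
    · exact ⟨x, hx, Multiset.mem_add.2 (.inr h)⟩

/-- Steps which do not consume a `Y` of level `j` keep all of them. -/
theorem replicate_le_of_ne {j : Fin (k + 1)} {s : ℕ} {X : Var k} {η ρ : Multiset (Var k)}
    (hX : X ≠ (.Y, j)) (h : Multiset.replicate s (Kind.Y, j) ≤ X ::ₘ ρ) :
    Multiset.replicate s (Kind.Y, j) ≤ η + ρ := by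
  rw [Multiset.le_cons_of_notMem fun hm => hX (Multiset.eq_of_mem_replicate hm)] at h
  exact h.trans (Multiset.le_add_left ..)

theorem replicate_pred_le {j : Fin (k + 1)} {s : ℕ} {X : Var k} {η ρ : Multiset (Var k)}
    (h : Multiset.replicate s (Kind.Y, j) ≤ X ::ₘ ρ) :
    Multiset.replicate (s - 1) (Kind.Y, j) ≤ η + ρ := by
  by_cases hX : X = (.Y, j)
  · subst hX
    cases s with
    | zero => exact Multiset.zero_le _
    | succ s =>
      rw [Multiset.replicate_succ, Multiset.cons_le_cons_iff] at h
      exact h.trans (Multiset.le_add_left ..)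
  · exact ((Multiset.replicate_le_replicate _).2 (Nat.sub_le s 1)).trans (replicate_le_of_ne hX h)

/-- `Y` has no silent rule, so it disappears only through visible actions. -/
theorem replicate_le_of_silentSteps {j : Fin (k + 1)} {s : ℕ} {p q : Multiset (Var k)}
    (hp : Multiset.replicate s (Kind.Y, j) ≤ p) (h : (system k).SilentSteps p q) :
    Multiset.replicate s (Kind.Y, j) ≤ q := by
  induction h with
  | refl => exact hp
  | tail _ hs ih =>
    obtain ⟨X, η, ρ, hr, rfl, rfl⟩ := step_iff.1 hs
    refine replicate_le_of_ne ?_ ih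
    rintro rfl
    cases hr with
    | spawn _ hx => exact hx rfl

/-- A generator at `G` can silently produce any number of `Y`. -/
theorem silentSteps_pump (i : Fin (k + 1)) (s : ℕ) (ρ : Multiset (Var k)) :
    (system k).SilentSteps ({(.G, i)} + ρ)
      (Multiset.replicate s (Kind.Y, i) + ({(.G, i)} + ρ)) := by
  induction s with
  | zero => rw [Multiset.replicate_zero, zero_add]; exact .refl
  | succ s ih =>
    refine ih.tail ?_
    have := (Rule.pump i).step (Multiset.replicate s (Kind.Y, i) + ρ)
    convert this using 1
    · rw [Multiset.singleton_add, Multiset.add_cons]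
    · rw [Multiset.replicate_succ, Multiset.insert_eq_cons]
      simp only [← Multiset.singleton_add]
      abel

/-! ### Duplicator's strategy in the long-long game -/

/-- The budget ω * j + s after one round: spend one `Y`, or, if none is left, go down a level. An
ordinal below ω * (i + 1) is at most ω * i + t for some finite t, and this t is the number of `Y` to
pump. -/
theorem pred_bound {o : Ordinal.{0}} {j s : ℕ} (h : o + 1 ≤ Ordinal.omega0 * j + s) :
    (∃ t, s = t + 1 ∧ o ≤ Ordinal.omega0 * j + t) ∨
    (s = 0 ∧ ∃ i t : ℕ, j = i + 1 ∧ o ≤ Ordinal.omega0 * i + t) := by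
  cases s with
  | succ t =>
    left
    refine ⟨t, rfl, ?_⟩
    rw [Nat.cast_add, Nat.cast_one, ← add_assoc, Order.add_one_le_iff, Order.lt_add_one_iff] at h
    exact h
  | zero =>
    right
    refine ⟨rfl, ?_⟩
    cases j with
    | zero => simp at h
    | succ i =>
      rw [Nat.cast_zero, add_zero, Order.add_one_le_iff, Nat.cast_add, Nat.cast_one, mul_add,
        mul_one, Ordinal.lt_add_iff Ordinal.omega0_ne_zero] at h
      obtain ⟨d, hd, h⟩ := h
      obtain ⟨t, rfl⟩ := Ordinal.lt_omega0.1 hd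
      exact ⟨i, t, rfl, h⟩

theorem pred_bound_sub {o : Ordinal.{0}} {j s : ℕ} (h : o + 1 ≤ Ordinal.omega0 * j + s) :
    o ≤ Ordinal.omega0 * j + (s - 1 : ℕ) := by
  rcases pred_bound h with ⟨t, rfl, ht⟩ | ⟨rfl, -⟩
  · exact ht
  · exact le_self_add.trans h

/-- Duplicator survives `ω * j + s` rounds from a process containing `A` at level `j` against a
process containing a generator of level `j` and `s` copies of `Y` of level `j`. -/
theorem longLongApprox_of_le (o : Ordinal.{0}) (j : Fin (k + 1)) (s : ℕ) (p q : Multiset (Var k))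
    (ho : o ≤ Ordinal.omega0 * (j : ℕ) + s) (hA : (Kind.A, j) ∈ p) (hp : From j p)
    (hq : From j q) (hg : HasGen j q) (hs : Multiset.replicate s (Kind.Y, j) ≤ q) :
    (system k).LongLongApprox o p q := by
  induction o using Ordinal.limitRecOn generalizing j s p q with
  | zero => exact BPP.approximant_zero _ _ _ _
  | limit o hlim ih =>
    exact (BPP.approximant_limit _ _ o hlim _ _).2 fun i hi =>
      ih i hi j s p q (hi.le.trans ho) hA hp hq hg hs
  | add_one o ih =>
    have ho' : o ≤ Ordinal.omega0 * (j : ℕ) + s := (Order.le_succ o).trans ho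
    rw [BPP.LongLongApprox, ← Order.succ_eq_add_one, BPP.approximant_succ]
    refine ⟨?_, ?_⟩
    · rintro a p' (⟨rfl, h⟩ | ⟨ha, p0, p1, h0, h1, h2⟩)
      · exact ⟨q, .inl ⟨rfl, .refl⟩, ih j s p' q ho' (mem_A_of_silentSteps hA h)
          (hp.silentSteps h) hq hg hs⟩
      have hA0 := mem_A_of_silentSteps hA h0
      have hp0 := hp.silentSteps h0
      obtain ⟨⟨x, l⟩, η, ρ, hr, rfl, rfl⟩ := step_iff.1 h1
      have hρ := hp0.tail
      rcases (hp0 _ (Multiset.mem_cons_self ..)).lt_or_eq with hl | hl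
      · have hA1 : (Kind.A, j) ∈ η + ρ := by
          rcases Multiset.mem_cons.1 hA0 with h | h
          · rw [← h] at hl; exact absurd hl (lt_irrefl _)
          · simp [h]
        exact ⟨η + q, hg.weakStep hl hr, ih j s _ _ ho' (mem_A_of_silentSteps hA1 h2)
          (((hr.from_of_lt hl).add hρ).silentSteps h2) ((hr.from_of_lt hl).add hq)
          (hg.mono fun _ => Multiset.mem_add.2 ∘ .inr) (hs.trans (Multiset.le_add_left ..))⟩
      dsimp only at hl
      subst hl
      rcases hr.visible ha with ⟨rfl, hle, hx⟩ | ⟨rfl, i, hi, rfl⟩ | ⟨rfl, i, hi, rfl⟩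
      · have hA1 : (Kind.A, j) ∈ η + ρ := by
          rcases Multiset.mem_cons.1 hA0 with h | h
          · rcases hx with rfl | rfl
            · simp at h
            · simp [h]
          · simp [h]
        have hη : From j η := by
          intro z hz
          rw [Multiset.mem_singleton.1 (Multiset.mem_of_le hle hz)]
        exact ⟨q, hg.loop, ih j s _ _ ho' (mem_A_of_silentSteps hA1 h2)
          ((hη.add hρ).silentSteps h2) hq hg hs⟩
      -- Spoiler descends to `G`; the generator in `q` does the same, and the pair is bisimilar from
      -- then on.
      · obtain ⟨x, hx, hm⟩ := hg
        obtain ⟨q, rfl⟩ := Multiset.exists_cons_of_mem hm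
        obtain ⟨q', h3, h4⟩ := (sameCore_of_from hi hρ hq.tail).weakBisimilar.silentSteps h2
        exact ⟨q', ((Rule.down x hx i j hi).step q).weakStep.trans_silent h3,
          h4.longLongApprox o⟩
      · have hij : i ≤ j := Fin.le_def.2 (by omega)
        -- The critical move, `A` descending to `A`: a remaining `Y` matches it exactly; otherwise
        -- Duplicator descends to `G` and pumps t copies of `Y`.
        rcases pred_bound ho with ⟨t, rfl, -⟩ | ⟨rfl, i', t, hi', ho''⟩
        · have hm : (Kind.Y, j) ∈ q := Multiset.mem_of_le hs (by simp)
          obtain ⟨q, rfl⟩ := Multiset.exists_cons_of_mem hm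
          obtain ⟨q', h3, h4⟩ := (sameTop_of_from hij hρ hq.tail).weakBisimilar.silentSteps h2
          exact ⟨q', ((Rule.lower .Y (.inr rfl) i j hi).step q).weakStep.trans_silent h3,
            h4.longLongApprox o⟩
        · obtain rfl : (i : ℕ) = i' := by omega
          obtain ⟨x, hx, hm⟩ := hg
          obtain ⟨q, rfl⟩ := Multiset.exists_cons_of_mem hm
          have hsing : ∀ y : Kind, From i ({(y, i)} : Multiset (Var k)) := by
            intro y z hz
            rw [Multiset.mem_singleton.1 hz]
          refine ⟨_, ((Rule.down x hx i j hi'.symm).step q).weakStep.trans_silent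
            (silentSteps_pump i t q), ih i t _ _ ho'' (mem_A_of_silentSteps (by simp) h2)
            (((hsing _).add (hρ.mono hij)).silentSteps h2)
            ((((hsing _).add (hq.tail.mono hij))).silentSteps (silentSteps_pump i t q))
            ⟨.G, by simp, by simp⟩ (Multiset.le_add_right ..)⟩
    · rintro a q' (⟨rfl, h⟩ | ⟨ha, q0, q1, h0, h1, h2⟩)
      · exact ⟨p, .inl ⟨rfl, .refl⟩, ih j s p q' ho' hA hp (hq.silentSteps h) (hg.silentSteps h)
          (replicate_le_of_silentSteps hs h)⟩
      have hq0 := hq.silentSteps h0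
      have hg0 := hg.silentSteps h0
      have hs0 := replicate_le_of_silentSteps hs h0
      obtain ⟨⟨x, l⟩, η, ρ, hr, rfl, rfl⟩ := step_iff.1 h1
      have hρ := hq0.tail
      rcases (hq0 _ (Multiset.mem_cons_self ..)).lt_or_eq with hl | hl
      · have hg1 : HasGen j (η + ρ) := by
          obtain ⟨y, hy, hm⟩ := hg0
          rcases Multiset.mem_cons.1 hm with h | h
          · rw [← h] at hl; exact absurd hl (lt_irrefl _)
          · exact ⟨y, hy, by simp [h]⟩
        have hs1 : Multiset.replicate s (Kind.Y, j) ≤ η + ρ := by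
          refine replicate_le_of_ne (fun h => ?_) hs0
          rw [h] at hl; exact absurd hl (lt_irrefl _)
        exact ⟨η + p, HasGen.weakStep ⟨.A, by simp, hA⟩ hl hr, ih j s _ _ ho' (by simp [hA])
          ((hr.from_of_lt hl).add hp) (((hr.from_of_lt hl).add hρ).silentSteps h2)
          (hg1.silentSteps h2) (replicate_le_of_silentSteps hs1 h2)⟩
      dsimp only at hl
      subst hl
      rcases hr.visible ha with ⟨rfl, hle, hx⟩ | ⟨rfl, i, hi, rfl⟩ | ⟨rfl, i, hi, rfl⟩
      · have hg1 : HasGen j (η + ρ) := by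
          obtain ⟨y, hy, hm⟩ := hg0
          rcases Multiset.mem_cons.1 hm with h | h
          · rcases hx with rfl | rfl
            · exact absurd (congrArg Prod.fst h) hy
            · exact ⟨y, hy, by simp [h]⟩
          · exact ⟨y, hy, by simp [h]⟩
        have hη : From j η := by
          intro z hz
          rw [Multiset.mem_singleton.1 (Multiset.mem_of_le hle hz)]
        -- The only visible action in this round may have consumed a `Y`, so s falls by at most one,
        -- as the ordinal has.
        exact ⟨p, HasGen.loop ⟨.A, by simp, hA⟩, ih j (s - 1) _ _ (pred_bound_sub ho) hA hp
          ((hη.add hρ).silentSteps h2) (hg1.silentSteps h2)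
          (replicate_le_of_silentSteps (replicate_pred_le hs0) h2)⟩
      · obtain ⟨p, rfl⟩ := Multiset.exists_cons_of_mem hA
        obtain ⟨p', h3, h4⟩ := (sameCore_of_from hi hρ hp.tail).weakBisimilar.silentSteps h2
        exact ⟨p', ((Rule.down .A (by simp) i j hi).step p).weakStep.trans_silent h3,
          h4.symm.longLongApprox o⟩
      · obtain ⟨p, rfl⟩ := Multiset.exists_cons_of_mem hA
        obtain ⟨p', h3, h4⟩ := (sameTop_of_from (Fin.le_def.2 (by omega)) hρ
          hp.tail).weakBisimilar.silentSteps h2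
        exact ⟨p', ((Rule.lower .A (.inl rfl) i j hi).step p).weakStep.trans_silent h3,
          h4.symm.longLongApprox o⟩

/-! ### Spoiler's strategy in the bisimulation game -/

/-- All variables of `q` have level at least `j`, and those of level `j` are `B`. -/
def Spent (j : Fin (k + 1)) (q : Multiset (Var k)) : Prop := ∀ z ∈ q, z = (.B, j) ∨ j < z.2

theorem Spent.silentSteps {j : Fin (k + 1)} {p q : Multiset (Var k)} (hp : Spent j p)
    (h : (system k).SilentSteps p q) : Spent j q := by
  induction h with
  | refl => exact hp
  | tail _ hs ih =>
    obtain ⟨X, η, ρ, hr, rfl, rfl⟩ := step_iff.1 hs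
    intro z hz
    rcases Multiset.mem_add.1 hz with hz | hz
    · rcases ih X (Multiset.mem_cons_self ..) with rfl | hX
      · obtain ⟨_, _, _, w, hw⟩ := hr
        simp only [Multiset.insert_eq_cons, Multiset.mem_cons, Multiset.mem_singleton] at hz
        rcases hz with rfl | rfl
        exacts [.inl rfl, .inr hw]
      · exact .inr (hX.trans_le (hr.from_of_silent z hz))
    · exact ih z (Multiset.mem_cons_of_mem hz)

/-- All variables of `q` have level at least `j`, and `A` of level `j` does not occur. -/
def NoTop (j : Fin (k + 1)) (q : Multiset (Var k)) : Prop := From j q ∧ (Kind.A, j) ∉ q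

theorem NoTop.silentSteps {j : Fin (k + 1)} {p q : Multiset (Var k)} (hp : NoTop j p)
    (h : (system k).SilentSteps p q) : NoTop j q := by
  induction h with
  | refl => exact hp
  | tail _ hs ih =>
    refine ⟨ih.1.silentSteps (.single hs), fun hm => ?_⟩
    obtain ⟨X, η, ρ, hr, rfl, rfl⟩ := step_iff.1 hs
    have hX := ih.1 X (Multiset.mem_cons_self ..)
    rcases Multiset.mem_add.1 hm with hm | hm
    · have hne : X ≠ (.A, j) := fun h => ih.2 (h ▸ Multiset.mem_cons_self ..)
      cases hr with
      | spawn x hx l z h =>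
        simp only [Multiset.insert_eq_cons, Multiset.mem_cons, Multiset.mem_singleton] at hm
        rcases hm with hm | rfl
        exacts [hne hm.symm, absurd (hX.trans_lt h) (lt_irrefl _)]
      | pump l => simp at hm
      | freeze l => simp at hm
    · exact ih.2 (Multiset.mem_cons_of_mem hm)

/-- Only a `B` of level j can perform `(true, j)`, and it becomes `G` one level down. No `A` appears
at that level, since spawning goes strictly upwards. At level 0 no such step exists. -/
theorem Spent.weakStep {j : Fin (k + 1)} {q q' : Multiset (Var k)} (hq : Spent j q)
    (h : (system k).WeakStep (some (true, j)) q q') :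
    ∃ i : Fin (k + 1), (i : ℕ) + 1 = j ∧ NoTop i q' := by
  rcases h with ⟨h, -⟩ | ⟨-, q0, q1, h0, h1, h2⟩
  · exact absurd h (by simp)
  have h3 := hq.silentSteps h0
  obtain ⟨X, η, ρ, hr, rfl, rfl⟩ := step_iff.1 h1
  have hX := h3 X (Multiset.mem_cons_self ..)
  cases hr with
  | down x hx i l hi =>
    refine ⟨i, hi, NoTop.silentSteps ?_ h2⟩
    have hlt : ∀ z ∈ ρ, i < z.2 := by
      intro z hz
      have hij : i < j := Fin.lt_def.2 (by omega)
      rcases h3 z (Multiset.mem_cons_of_mem hz) with rfl | h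
      exacts [hij, hij.trans h]
    refine ⟨fun z hz => ?_, fun hm => ?_⟩
    · rcases Multiset.mem_add.1 hz with hz | hz
      · rw [Multiset.mem_singleton.1 hz]
      · exact (hlt z hz).le
    · rcases Multiset.mem_add.1 hm with hm | hm
      · simp at hm
      · exact lt_irrefl _ (hlt _ hm)
  | lower x hx i l hi =>
    rcases hX with hX | hX
    · obtain rfl : x = .B := congrArg Prod.fst hX
      simp at hx
    · exact absurd hX (lt_irrefl _)

theorem mem_A_of_weakStep {j : Fin (k + 1)} {p p' : Multiset (Var k)} (hA : (Kind.A, j) ∈ p)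
    (h : (system k).WeakStep none p p' ∨ (system k).WeakStep (some (false, j)) p p') :
    (Kind.A, j) ∈ p' := by
  rcases h with h | ⟨h, -⟩ | ⟨-, p0, p1, h0, h1, h2⟩
  · exact mem_A_of_silentSteps hA h.silent
  · exact absurd h (by simp)
  · refine mem_A_of_silentSteps ?_ h2
    have hA0 := mem_A_of_silentSteps hA h0
    obtain ⟨X, η, ρ, hr, rfl, rfl⟩ := step_iff.1 h1
    rcases Multiset.mem_cons.1 hA0 with rfl | hm
    · cases hr; simp
    · simp [hm]

theorem NoTop.decompose {j : Fin (k + 1)} {q : Multiset (Var k)} (hq : NoTop j q) :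
    ∃ σ ρ, q = σ + ρ ∧ (∀ z ∈ σ, z = (Kind.Y, j) ∨ z = (Kind.G, j)) ∧ Spent j ρ := by
  classical
  refine ⟨_, _, (Multiset.filter_add_not (fun z => z = (Kind.Y, j) ∨ z = (Kind.G, j)) q).symm,
    fun z hz => (Multiset.mem_filter.1 hz).2, fun z hz => ?_⟩
  obtain ⟨hz, hn⟩ := Multiset.mem_filter.1 hz
  rcases (hq.1 z hz).lt_or_eq with h | h
  · exact .inr h
  · left
    obtain ⟨x, l⟩ := z
    obtain rfl : j = l := h
    cases x with
    | A => exact absurd hz hq.2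
    | B => rfl
    | G => simp at hn
    | Y => simp at hn

/-- Spoiler wins from `A` of level `j` against processes of levels at least `j` without it. -/
theorem not_weakBisimilar (n : ℕ) (j : Fin (k + 1)) (hj : (j : ℕ) = n) (p q : Multiset (Var k))
    (hA : (Kind.A, j) ∈ p) (hq : NoTop j q) : ¬ (system k).WeakBisimilar p q := by
  induction n using Nat.strong_induction_on generalizing j p q with
  | _ n ih =>
    obtain ⟨σ, ρ, rfl, hσ, hρ⟩ := hq.decompose
    clear hq
    -- `σ` lists the `Y` and `G` still to be removed; Duplicator's replies meanwhile cannot lose the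
    -- `A` of level j.
    induction σ using Multiset.induction_on generalizing p ρ with
    | empty =>
      intro h
      rw [zero_add] at h
      obtain ⟨p, rfl⟩ := Multiset.exists_cons_of_mem hA
      let i : Fin (k + 1) := ⟨j - 1, by omega⟩
      obtain ⟨q', h1, h2⟩ := h.step ((Rule.lower .A (.inl rfl) i j rfl).step p)
      obtain ⟨i', hi, hq'⟩ := hρ.weakStep h1
      -- Here `hi` forces j to be positive, so truncation plays no role and the level really drops.
      obtain rfl : i = i' := Fin.ext (by simp only [i]; omega)
      exact ih i (by omega) i rfl _ q' (by simp) hq' h2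
    | cons z σ ihσ =>
      intro h
      have hσ' := fun w hw => hσ w (Multiset.mem_cons_of_mem hw)
      rw [Multiset.cons_add] at h
      rcases hσ z (Multiset.mem_cons_self ..) with rfl | rfl
      · obtain ⟨p', h1, h2⟩ := h.symm.step ((Rule.consume j).step (σ + ρ))
        rw [zero_add] at h2
        exact ihσ p' (mem_A_of_weakStep hA (.inr h1)) ρ hσ' hρ h2.symm
      · obtain ⟨p', h1, h2⟩ := h.symm.step ((Rule.freeze j).step (σ + ρ))
        rw [Multiset.singleton_add, ← Multiset.add_cons] at h2
        refine ihσ p' (mem_A_of_weakStep hA (.inl h1)) _ hσ' (fun w hw => ?_) h2.symm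
        rcases Multiset.mem_cons.1 hw with rfl | hw
        exacts [.inl rfl, hρ w hw]

/-! ### Conclusion -/

/-- One system serves all `o` up to ω * k, so no monotonicity of the approximants is needed below
ω². -/
theorem weakBisimilar_ne_longLongApprox (k : ℕ) {o : Ordinal.{0}} (ho : o ≤ Ordinal.omega0 * k) :
    (system k).WeakBisimilar ≠ (system k).LongLongApprox o := by
  intro h
  have hsing : ∀ y : Kind, From (Fin.last k) ({(y, Fin.last k)} : Multiset (Var k)) := by
    intro y z hz
    rw [Multiset.mem_singleton.1 hz]
  have h1 : (system k).LongLongApprox o {(Kind.A, Fin.last k)} {(Kind.B, Fin.last k)} :=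
    longLongApprox_of_le o (Fin.last k) 0 _ _ (by simpa using ho) (by simp) (hsing _) (hsing _)
      ⟨.B, by simp, by simp⟩ (Multiset.zero_le _)
  rw [← h] at h1
  exact not_weakBisimilar _ _ rfl _ _ (by simp) ⟨hsing _, by simp⟩ h1

end Ladder

theorem mainTheorem1 :
    (∀ k : ℕ, ∃ S : BPP, S.WeakBisimilar ≠ S.LongLongApprox (Ordinal.omega0 * (k : Ordinal.{0}))) ∧
    (∀ o : Ordinal.{0}, o < Ordinal.omega0 * Ordinal.omega0 →
      ¬ ∀ S : BPP, S.WeakBisimilar = S.LongLongApprox o) ∧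
    (¬ ∀ S : BPP, S.WeakBisimilar = S.LongLongApprox (Ordinal.omega0 + Ordinal.omega0)) := by
  refine ⟨fun k => ⟨_, Ladder.weakBisimilar_ne_longLongApprox k le_rfl⟩, fun o ho h => ?_,
    fun h => ?_⟩
  · obtain ⟨c, hc, hlt⟩ :=
      (Ordinal.lt_mul_iff_of_isSuccLimit Ordinal.isSuccLimit_omega0).1 ho
    obtain ⟨k, rfl⟩ := Ordinal.lt_omega0.1 hc
    exact Ladder.weakBisimilar_ne_longLongApprox k hlt.le (h _)
  · refine Ladder.weakBisimilar_ne_longLongApprox 2 ?_ (h _)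
    rw [show ((2 : ℕ) : Ordinal.{0}) = 1 + 1 by norm_num, mul_add, mul_one]
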